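/- A real function \(f\) on an interval \(I\subseteq\mathbb R\) is called \(n\)-convex if \(f(\lambda A+(1-\lambda)B)\le\lambda f(A)+(1-\lambda)f(B)\) for every \(\lambda\in[0,1]\) and all Hermitian \(n\times n\) matrices \(A,B\) with spectra in \(I\), where \(f(A)\) is given by the functional calculus and \(\le\) is the Loewner order (\(X\le Y\) iff \(Y-X\) is positive semidefinite). It is called \(n\)-concave if \(-f\) is \(n\)-convex, and \(n\)-monotone if \(A\le B\) implies \(f(A)\le f(B)\) for all Hermitian \(n\times n\) matrices \(A,B\) with spectra in \(I\). Let \(I\) be a finite (that is, bounded) interval, open, closed or half-open, and let \(m\) and \(n\) be natural numbers with \(m\ge 2n\). Then there exists a real polynomial \(f_m\) of degree \(m\) whose restriction to \(I\) is both \(n\)-concave and \(n\)-monotone. Likewise there exists a real polynomial \(g_m\) of degree \(m\) whose restriction to \(I\) is both \(n\)-convex and \(n\)-monotone. -/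

import Mathlib

section MatrixFunctions

open scoped MatrixOrder

/-- A real function `f` is `n`-convex on `I` if
`f (l A + (1 - l) B) ≤ l f(A) + (1 - l) f(B)` in the Loewner order, for all `l ∈ [0, 1]` and all
Hermitian complex `n × n` matrices `A`, `B` with spectra in `I`. Here `f(A)` is `cfc f A`, which for
a Hermitian matrix is `U diag(f(λ₁), …, f(λₙ)) U*` when `A = U diag(λ₁, …, λₙ) U*`; the spectrum is
finite, so no continuity of `f` is needed, and only the values of `f` on the spectrum matter. -/
def IsMatrixConvexOn (n : ℕ) (I : Set ℝ) (f : ℝ → ℝ) : Prop :=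
  ∀ A B : Matrix (Fin n) (Fin n) ℂ, A.IsHermitian → B.IsHermitian →
    spectrum ℝ A ⊆ I → spectrum ℝ B ⊆ I →
    ∀ l ∈ Set.Icc (0 : ℝ) 1,
      cfc f (l • A + (1 - l) • B) ≤ l • cfc f A + (1 - l) • cfc f B

/-- `f` is `n`-concave on `I` if `-f` is `n`-convex on `I`. -/
def IsMatrixConcaveOn (n : ℕ) (I : Set ℝ) (f : ℝ → ℝ) : Prop :=
  IsMatrixConvexOn n I (fun t => -f t)

/-- A real function `f` is `n`-monotone on `I` if `A ≤ B` implies `f(A) ≤ f(B)` (Loewner order)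
for all Hermitian complex `n × n` matrices `A`, `B` with spectra in `I`. -/
def IsMatrixMonotoneOn (n : ℕ) (I : Set ℝ) (f : ℝ → ℝ) : Prop :=
  ∀ A B : Matrix (Fin n) (Fin n) ℂ, A.IsHermitian → B.IsHermitian →
    spectrum ℝ A ⊆ I → spectrum ℝ B ⊆ I →
    A ≤ B → cfc f A ≤ cfc f B

end MatrixFunctions

/-!
For the convex case, take the polynomial `g = ∑ k ≤ m, a k * ε ^ k * t ^ k`, where
`a k = 1 ^ k + ⋯ + n ^ k` is the `k`-th moment of `n` positive atoms and `ε` is small depending on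
`I`, `m` and `n`. The Hankel matrices `a (i + j + 1)` and `a (i + j + 2)` with `i, j < n` are both
positive definite (`exists_le_sum_powerMoment_mul_inner`); since `2 * n ≤ m`, all their entries are
coefficients of `g` up to powers of `ε`.

Let `X` be self-adjoint. The first derivative of `g` at `X` in the direction `S† S` has the
quadratic form `∑ g_{p+r+1} ⟪S X ^ p w, S X ^ r w⟫`, and half the second derivative in the direction
`D` has the form `∑ g_{p+q+r+2} ⟪D X ^ p w, X ^ q D X ^ r w⟫`. The terms with `p, r < n` and `q = 0`
make up a Hankel form, which is bounded below. By Cayley–Hamilton the vectors with `p ≥ n` are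
bounded by those with `p < n`, uniformly for spectra in a bounded set (`exists_norm_map_pow_le`), so
each remaining term carries an extra factor `ε`, and for small `ε` the Hankel form wins
(`exists_pos_forall_scaled_form_nonneg`). Hence along every segment of self-adjoint operators of
bounded norm `g` is convex, and along increasing segments it is monotone
(`exists_pos_momentPolynomial_monotone_convex`).

The concave case follows by the reflection `f t = -g (-t)`, applied with `-I` in place of `I`.
-/

open Finset Polynomial

/-! ### Hankel forms of moments -/

/-- The `k`-th moment `1 ^ k + 2 ^ k + ⋯ + n ^ k` of the counting measure on `{1, …, n}`. -/
noncomputable def powerMoment (n k : ℕ) : ℝ := ∑ i : Fin n, ((i : ℝ) + 1) ^ k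

lemma powerMoment_pos {n : ℕ} (hn : 0 < n) (k : ℕ) : 0 < powerMoment n k := by
  have : Nonempty (Fin n) := ⟨⟨0, hn⟩⟩
  exact sum_pos (fun i _ => by positivity) univ_nonempty

section Moments

variable {E : Type*} [NormedAddCommGroup E] [InnerProductSpace ℂ E]

lemma sum_powerMoment_mul_inner (n s : ℕ) (v : ℕ → E) :
    ∑ p ∈ range n, ∑ r ∈ range n, powerMoment n (p + r + s) * (inner ℂ (v p) (v r)).re =
      ∑ i : Fin n, ((i : ℝ) + 1) ^ s *
        ‖∑ p ∈ range n, (((i : ℝ) + 1) ^ p : ℝ) • v p‖ ^ 2 := by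
  have key : ∀ i : Fin n, ‖∑ p ∈ range n, (((i : ℝ) + 1) ^ p : ℝ) • v p‖ ^ 2 =
      ∑ p ∈ range n, ∑ r ∈ range n, ((i : ℝ) + 1) ^ (p + r) * (inner ℂ (v p) (v r)).re := by
    intro i
    rw [← inner_self_eq_norm_sq (𝕜 := ℂ), sum_inner, map_sum]
    refine sum_congr rfl fun p _ => ?_
    rw [inner_sum, map_sum]
    refine sum_congr rfl fun r _ => ?_
    rw [inner_smul_left_eq_smul, inner_smul_right_eq_smul, RCLike.smul_re, RCLike.smul_re, pow_add]
    simp [mul_assoc]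
  simp_rw [key, powerMoment, sum_mul, mul_sum]
  rw [sum_congr rfl fun p _ => sum_comm, sum_comm]
  refine sum_congr rfl fun i _ => sum_congr rfl fun p _ => sum_congr rfl fun r _ => ?_
  ring

/-- The Hankel forms of the moments of `{1, …, n}` are positive definite: a vanishing form forces a
polynomial of degree less than `n` to vanish at `n` points. The bound is uniform in the shift `s`
because all the atoms are at least `1`. -/
lemma exists_le_sum_powerMoment_mul_inner (n : ℕ) :
    ∃ c > 0, ∀ (s : ℕ) (v : ℕ → E), c * (∑ p ∈ range n, ‖v p‖) ^ 2 ≤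
      ∑ p ∈ range n, ∑ r ∈ range n, powerMoment n (p + r + s) * (inner ℂ (v p) (v r)).re := by
  set V : Matrix (Fin n) (Fin n) ℝ := Matrix.vandermonde fun i : Fin n => (i : ℝ) + 1 with hV
  have hdet : IsUnit V.det := by
    rw [isUnit_iff_ne_zero, hV, Matrix.det_vandermonde_ne_zero_iff]
    intro i j h
    simpa [Fin.ext_iff] using h
  set C : ℝ := ∑ p, ∑ i, |V⁻¹ p i| + 1 with hC
  have hC0 : 0 < C := by positivity
  refine ⟨(C ^ 2 * (n + 1))⁻¹, by positivity, fun s v => ?_⟩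
  -- The Vandermonde matrix recovers the vectors `v p` from the values `y i` at the atoms.
  set y : Fin n → E := fun i => ∑ p ∈ range n, (((i : ℝ) + 1) ^ p : ℝ) • v p with hy
  have hinv : ∀ p : Fin n, v p = ∑ i, V⁻¹ p i • y i := by
    intro p
    have hy' : ∀ i, y i = ∑ q : Fin n, V i q • v q := fun i => by
      simp [hy, hV, Matrix.vandermonde_apply, Finset.sum_range]
    simp_rw [hy', smul_sum, smul_smul]
    rw [sum_comm]
    simp_rw [← sum_smul, ← Matrix.mul_apply, Matrix.nonsing_inv_mul V hdet, Matrix.one_apply]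
    simp
  have h1 : ∑ p ∈ range n, ‖v p‖ ≤ C * ∑ i, ‖y i‖ := by
    rw [Finset.sum_range]
    calc ∑ p : Fin n, ‖v p‖ ≤ ∑ p : Fin n, ∑ i, |V⁻¹ p i| * ∑ j, ‖y j‖ := by
          refine sum_le_sum fun p _ => ?_
          rw [hinv p]
          refine (norm_sum_le _ _).trans (sum_le_sum fun i _ => ?_)
          rw [norm_smul, Real.norm_eq_abs]
          gcongr
          exact single_le_sum (f := fun j => ‖y j‖) (fun j _ => norm_nonneg _) (mem_univ i)
      _ = (∑ p, ∑ i, |V⁻¹ p i|) * ∑ j, ‖y j‖ := by simp_rw [sum_mul]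
      _ ≤ _ := by gcongr; linarith
  have h2 : (∑ i, ‖y i‖) ^ 2 ≤ n * ∑ i, ‖y i‖ ^ 2 := by
    simpa using sq_sum_le_card_mul_sum_sq (s := univ) (f := fun i => ‖y i‖)
  have h3 : ∑ i, ‖y i‖ ^ 2 ≤
      ∑ p ∈ range n, ∑ r ∈ range n, powerMoment n (p + r + s) * (inner ℂ (v p) (v r)).re := by
    rw [sum_powerMoment_mul_inner]
    refine sum_le_sum fun i _ => ?_
    have : (1 : ℝ) ≤ ((i : ℝ) + 1) ^ s := one_le_pow₀ (by simp)
    exact le_mul_of_one_le_left (by positivity) this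
  refine le_trans ?_ h3
  rw [inv_mul_le_iff₀ (by positivity)]
  have h0 : 0 ≤ ∑ i, ‖y i‖ ^ 2 := by positivity
  calc (∑ p ∈ range n, ‖v p‖) ^ 2 ≤ (C * ∑ i, ‖y i‖) ^ 2 := by gcongr
    _ = C ^ 2 * (∑ i, ‖y i‖) ^ 2 := by ring
    _ ≤ C ^ 2 * (n * ∑ i, ‖y i‖ ^ 2) := by gcongr
    _ ≤ C ^ 2 * (n + 1) * ∑ i, ‖y i‖ ^ 2 := by nlinarith [mul_nonneg (sq_nonneg C) h0]

/-! ### Domination of the scaled form by its Hankel part -/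

/-- For small `ε`, the terms of the scaled form with `p < n`, `r < n`, `q = 0` dominate all the
others: if `p ≥ n`, then `ε ^ p * ‖u p‖` is at most a multiple of `ε * ∑ j < n, ε ^ j * ‖u j‖`. -/
lemma exists_pos_forall_scaled_form_nonneg {n Q : ℕ} (N : ℕ) (hQ : 0 < Q) (hnN : n ≤ N)
    (b : ℕ → ℝ) (s : ℕ)
    (hb : ∀ p < n, ∀ r < n, b (p + r) = powerMoment n (p + r + s)) {K : ℝ} (hK : 1 ≤ K) (R : ℝ) :
    ∃ ε₀ > 0, ∀ ε : ℝ, 0 < ε → ε ≤ ε₀ → ∀ (X : E →L[ℂ] E) (u : ℕ → E), ‖X‖ ≤ R →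
      (∀ p, ‖u p‖ ≤ K ^ p * ∑ j ∈ range n, ‖u j‖) →
      0 ≤ ∑ p ∈ range N, ∑ q ∈ range Q, ∑ r ∈ range N,
        b (p + q + r) * ε ^ (p + q + r) * (inner ℂ (u p) ((X ^ q) (u r))).re := by
  obtain ⟨c, hc, hcv⟩ := exists_le_sum_powerMoment_mul_inner (E := E) n
  set R₁ : ℝ := max R 1
  have hR₁ : 1 ≤ R₁ := le_max_right _ _
  set B : ℝ := ∑ k ∈ range (N + Q + N), |b k| with hB
  have hB0 : 0 ≤ B := by positivity
  set M : ℝ := B * R₁ ^ Q * (K ^ N) ^ 2 with hM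
  have hM0 : 0 ≤ M := by positivity
  -- There are `N * Q * N` terms, and each non-Hankel term is at most `M * ε * T ^ 2`;
  -- the `+ 1` only avoids a division by zero.
  refine ⟨min 1 (c / (N * (Q * (N * M)) + 1)), by positivity, fun ε hε hε' X u hX hu => ?_⟩
  have hε1 : ε ≤ 1 := hε'.trans (min_le_left _ _)
  have hεc : ε * (N * (Q * (N * M))) ≤ c := by
    have h : ε ≤ c / (N * (Q * (N * M)) + 1) := hε'.trans (min_le_right _ _)
    rw [le_div_iff₀ (by positivity)] at h
    linarith
  set v : ℕ → E := fun p => (ε ^ p : ℝ) • u p with hv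
  have hvn : ∀ p, ‖v p‖ = ε ^ p * ‖u p‖ := fun p => by
    simp [hv, norm_smul, abs_of_pos hε]
  set T : ℝ := ∑ j ∈ range n, ‖v j‖ with hT
  have hT0 : 0 ≤ T := by positivity
  have hup : ∀ p < N, ‖u p‖ ≤ K ^ N * ∑ j ∈ range n, ‖u j‖ := fun p hp => by
    have hKp : K ^ p ≤ K ^ N := pow_le_pow_right₀ hK hp.le
    exact (hu p).trans (by gcongr)
  have hlarge : ∀ p < N, n ≤ p → ‖v p‖ ≤ K ^ N * (ε * T) := fun p hp hnp => by
    rw [hvn]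
    calc ε ^ p * ‖u p‖ ≤ ε ^ p * (K ^ N * ∑ j ∈ range n, ‖u j‖) := by
          gcongr; exact hup p hp
      _ = K ^ N * ∑ j ∈ range n, ε ^ p * ‖u j‖ := by rw [← mul_sum]; ring
      _ ≤ K ^ N * ∑ j ∈ range n, ε * (ε ^ j * ‖u j‖) := by
          refine mul_le_mul_of_nonneg_left (sum_le_sum fun j hj => ?_) (by positivity)
          rw [← mul_assoc, ← pow_succ']
          have := mem_range.1 hj
          exact mul_le_mul_of_nonneg_right
            (pow_le_pow_of_le_one hε.le hε1 (by omega)) (norm_nonneg _)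
      _ = K ^ N * (ε * T) := by simp_rw [hT, hvn, mul_sum]
  have hall : ∀ p < N, ‖v p‖ ≤ K ^ N * T := fun p hp => by
    rcases lt_or_ge p n with h | h
    · calc ‖v p‖ ≤ T := single_le_sum (f := fun j => ‖v j‖) (fun j _ => norm_nonneg _)
            (mem_range.2 h)
        _ ≤ K ^ N * T := le_mul_of_one_le_left hT0 (one_le_pow₀ hK)
    · refine (hlarge p hp h).trans ?_
      gcongr
      exact mul_le_of_le_one_left hT0 hε1
  have hterm : ∀ p ∈ range N, ∀ q ∈ range Q, ∀ r ∈ range N,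
      (if p < n ∧ q = 0 ∧ r < n then
        powerMoment n (p + r + s) * (inner ℂ (v p) (v r)).re else 0) - M * (ε * T ^ 2) ≤
      b (p + q + r) * ε ^ (p + q + r) * (inner ℂ (u p) ((X ^ q) (u r))).re := by
    intro p hp q hq r hr
    rw [mem_range] at hp hq hr
    have hre : b (p + q + r) * ε ^ (p + q + r) * (inner ℂ (u p) ((X ^ q) (u r))).re =
        b (p + q + r) * (ε ^ q * (inner ℂ (v p) ((X ^ q) (v r))).re) := by
      simp only [hv]
      rw [ContinuousLinearMap.map_smul_of_tower, inner_smul_left_eq_smul, inner_smul_right_eq_smul]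
      simp only [Complex.real_smul, Complex.re_ofReal_mul]
      ring
    rw [hre]
    split_ifs with h
    · obtain ⟨hpn, rfl, hrn⟩ := h
      have : 0 ≤ M * (ε * T ^ 2) := by positivity
      simp only [add_zero, pow_zero, one_mul, one_apply_eq_self, hb p hpn r hrn]
      linarith
    · have hb' : |b (p + q + r)| ≤ B :=
        single_le_sum (f := fun k => |b k|) (fun k _ => abs_nonneg _) (mem_range.2 (by omega))
      have hXq : ‖X ^ q‖ ≤ R₁ ^ Q := by
        calc ‖X ^ q‖ ≤ R₁ ^ q := by
              rcases Nat.eq_zero_or_pos q with rfl | hq0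
              · rw [pow_zero, pow_zero]; exact ContinuousLinearMap.norm_id_le
              · exact (norm_pow_le' X hq0).trans
                  (pow_le_pow_left₀ (norm_nonneg _) (hX.trans (le_max_left _ _)) q)
          _ ≤ R₁ ^ Q := pow_le_pow_right₀ hR₁ hq.le
      have hin : |(inner ℂ (v p) ((X ^ q) (v r))).re| ≤ R₁ ^ Q * (‖v p‖ * ‖v r‖) := by
        calc _ ≤ ‖inner ℂ (v p) ((X ^ q) (v r))‖ := Complex.abs_re_le_norm _
          _ ≤ ‖v p‖ * ‖(X ^ q) (v r)‖ := norm_inner_le_norm _ _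
          _ ≤ ‖v p‖ * (R₁ ^ Q * ‖v r‖) := by
              gcongr; exact (X ^ q).le_of_opNorm_le hXq _
          _ = _ := by ring
      -- In each of the three cases one factor supplies the extra `ε`.
      have hprod : ε ^ q * (‖v p‖ * ‖v r‖) ≤ (K ^ N) ^ 2 * (ε * T ^ 2) := by
        have hq1 : ε ^ q ≤ 1 := pow_le_one₀ hε.le hε1
        have e : (K ^ N) ^ 2 * (ε * T ^ 2) = ε * (K ^ N * T * (K ^ N * T)) := by ring
        have e1 : (K ^ N) ^ 2 * (ε * T ^ 2) = 1 * (K ^ N * (ε * T) * (K ^ N * T)) := by ring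
        have e2 : (K ^ N) ^ 2 * (ε * T ^ 2) = 1 * (K ^ N * T * (K ^ N * (ε * T))) := by ring
        by_cases hp' : n ≤ p
        · rw [e1]
          exact mul_le_mul hq1 (mul_le_mul (hlarge p hp hp') (hall r hr) (norm_nonneg _)
            (by positivity)) (by positivity) zero_le_one
        by_cases hr' : n ≤ r
        · rw [e2]
          exact mul_le_mul hq1 (mul_le_mul (hall p hp) (hlarge r hr hr') (norm_nonneg _)
            (by positivity)) (by positivity) zero_le_one
        have hq0 : q ≠ 0 := fun h0 => h ⟨by omega, h0, by omega⟩
        have hqε : ε ^ q ≤ ε := pow_le_of_le_one hε.le hε1 hq0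
        rw [e]
        exact mul_le_mul hqε (mul_le_mul (hall p hp) (hall r hr) (norm_nonneg _)
            (by positivity)) (by positivity) hε.le
      have habs : |b (p + q + r) * (ε ^ q * (inner ℂ (v p) ((X ^ q) (v r))).re)| ≤
          M * (ε * T ^ 2) := by
        rw [abs_mul, abs_mul, abs_of_nonneg (pow_nonneg hε.le q)]
        calc _ ≤ B * (ε ^ q * (R₁ ^ Q * (‖v p‖ * ‖v r‖))) := by gcongr
          _ = B * R₁ ^ Q * (ε ^ q * (‖v p‖ * ‖v r‖)) := by ring
          _ ≤ B * R₁ ^ Q * ((K ^ N) ^ 2 * (ε * T ^ 2)) := by gcongr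
          _ = _ := by rw [hM]; ring
      linarith [neg_abs_le (b (p + q + r) * (ε ^ q * (inner ℂ (v p) ((X ^ q) (v r))).re))]
  refine le_trans ?_ (sum_le_sum fun p hp => sum_le_sum fun q hq => sum_le_sum fun r hr =>
    hterm p hp q hq r hr)
  have hmain : ∑ p ∈ range N, ∑ q ∈ range Q, ∑ r ∈ range N,
      (if p < n ∧ q = 0 ∧ r < n then
        powerMoment n (p + r + s) * (inner ℂ (v p) (v r)).re else 0) =
      ∑ p ∈ range n, ∑ r ∈ range n,
        powerMoment n (p + r + s) * (inner ℂ (v p) (v r)).re := by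
    have hfil : (range N).filter (· < n) = range n := by ext x; simp; omega
    rw [← hfil]
    simp_rw [sum_filter]
    refine sum_congr rfl fun p _ => ?_
    rw [sum_eq_single_of_mem 0 (mem_range.2 hQ)]
    · by_cases hp : p < n <;> simp [hp]
    · intro q _ hq
      simp [hq]
  simp_rw [sum_sub_distrib]
  rw [hmain]
  simp only [sum_const, card_range, nsmul_eq_mul]
  have h1 := hcv s v
  have h2 : ε * (N * (Q * (N * M))) * T ^ 2 ≤ c * T ^ 2 := by gcongr
  have e : (N : ℝ) * (Q * (N * (M * (ε * T ^ 2)))) = ε * (N * (Q * (N * M))) * T ^ 2 := by ring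
  rw [e]
  linarith

end Moments

/-! ### Uniform bounds from Cayley–Hamilton -/

section CayleyHamilton

variable {E : Type*} [NormedAddCommGroup E] [InnerProductSpace ℂ E] [FiniteDimensional ℂ E]

/-- By Cayley–Hamilton, with the coefficients of the characteristic polynomial bounded in terms of
its roots, the powers `X ^ p` with `p < finrank ℂ E` control all the others, uniformly for
`‖X‖ ≤ R`. -/
lemma exists_norm_map_pow_le (R : ℝ) :
    ∃ K : ℝ, 1 ≤ K ∧ ∀ (X L : E →L[ℂ] E) (w : E), ‖X‖ ≤ R → ∀ p,
      ‖L ((X ^ p) w)‖ ≤ K ^ p * ∑ j ∈ range (Module.finrank ℂ E), ‖L ((X ^ j) w)‖ := by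
  set n := Module.finrank ℂ E with hn
  set C : ℝ := max R 1 ^ n * n.choose (n / 2) with hC
  have hC0 : 0 ≤ C := by positivity
  have hK : 1 ≤ 1 + n * C := by linarith [mul_nonneg (Nat.cast_nonneg (α := ℝ) n) hC0]
  refine ⟨1 + n * C, hK, fun X L w hX p => ?_⟩
  set S : ℝ := ∑ j ∈ range n, ‖L ((X ^ j) w)‖ with hS
  have hS0 : 0 ≤ S := by positivity
  set f : Module.End ℂ E := (X : E →ₗ[ℂ] E) with hf
  have hcoe : ∀ (k : ℕ) (z : E), (f ^ k) z = (X ^ k) z := fun k z => by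
    rw [hf, ← ContinuousLinearMap.toLinearMap_pow]; rfl
  have hroot : ∀ z ∈ (f.charpoly.map (RingHom.id ℂ)).roots, ‖z‖ ≤ R := by
    intro z hz
    rw [Polynomial.map_id] at hz
    obtain ⟨x, hx⟩ := ((Module.End.hasEigenvalue_iff_isRoot_charpoly f z).2
      (isRoot_of_mem_roots hz)).exists_hasEigenvector
    have h1 : X x = z • x := hx.apply_eq_smul
    have h2 : ‖z‖ * ‖x‖ ≤ R * ‖x‖ := by
      rw [← norm_smul, ← h1]; exact X.le_of_opNorm_le hX x
    exact le_of_mul_le_mul_right h2 (norm_pos_iff.2 hx.2)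
  have hcoeff : ∀ i, ‖f.charpoly.coeff i‖ ≤ C := fun i => by
    simpa using coeff_bdd_of_roots_le (RingHom.id ℂ) f.charpoly_monic
      (IsAlgClosed.splits _) (f.charpoly_natDegree).le hroot i
  have hCH : ∀ z, (X ^ n) z = -∑ j ∈ range n, f.charpoly.coeff j • (X ^ j) z := by
    intro z
    have h := congrArg (fun g : Module.End ℂ E => g z) f.aeval_self_charpoly
    simp only [aeval_eq_sum_range, f.charpoly_natDegree, sum_range_succ] at h
    rw [← hn] at h
    have hlead : f.charpoly.coeff n = 1 := by
      have := f.charpoly_monic.coeff_natDegree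
      rwa [f.charpoly_natDegree] at this
    simp only [hlead, one_smul, LinearMap.add_apply, LinearMap.sum_apply, LinearMap.smul_apply,
      hcoe, LinearMap.zero_apply] at h
    exact eq_neg_of_add_eq_zero_right h
  have hstep : ∀ p, ‖L ((X ^ (p + n)) w)‖ ≤ ∑ j ∈ range n, C * ‖L ((X ^ (p + j)) w)‖ := by
    intro p
    have : (X ^ (p + n)) w = -∑ j ∈ range n, f.charpoly.coeff j • (X ^ (p + j)) w := by
      rw [add_comm, pow_add, mul_apply_eq_comp, hCH]
      simp_rw [← mul_apply_eq_comp, ← pow_add, add_comm]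
    rw [this, map_neg, norm_neg, map_sum]
    refine (norm_sum_le _ _).trans (sum_le_sum fun j _ => ?_)
    rw [map_smul, norm_smul]
    gcongr
    exact hcoeff j
  induction p using Nat.strong_induction_on with
  | _ p ih =>
    rcases lt_or_ge p n with h | h
    · calc ‖L ((X ^ p) w)‖ ≤ S :=
            single_le_sum (f := fun j => ‖L ((X ^ j) w)‖) (fun j _ => norm_nonneg _) (mem_range.2 h)
        _ ≤ _ := le_mul_of_one_le_left hS0 (one_le_pow₀ hK)
    · obtain ⟨q, rfl⟩ := Nat.exists_eq_add_of_le' h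
      rcases Nat.eq_zero_or_pos n with h0 | h0
      · refine (hstep q).trans ?_
        rw [h0, range_zero, sum_empty]
        positivity
      obtain ⟨k, hk⟩ : ∃ k, q + n = k + 1 := ⟨q + n - 1, by omega⟩
      calc ‖L ((X ^ (q + n)) w)‖ ≤ ∑ j ∈ range n, C * ‖L ((X ^ (q + j)) w)‖ := hstep q
        _ ≤ ∑ j ∈ range n, C * ((1 + n * C) ^ k * S) := by
            refine sum_le_sum fun j hj => mul_le_mul_of_nonneg_left ?_ hC0
            have hj' := mem_range.1 hj
            exact (ih (q + j) (by omega)).trans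
              (mul_le_mul_of_nonneg_right (pow_le_pow_right₀ hK (by omega)) hS0)
        _ = n * C * ((1 + n * C) ^ k * S) := by simp [mul_assoc]
        _ ≤ (1 + n * C) * ((1 + n * C) ^ k * S) := by gcongr; linarith
        _ = (1 + n * C) ^ (q + n) * S := by rw [hk, pow_succ']; ring

end CayleyHamilton

/-! ### Derivatives of powers and polynomials in a noncommutative algebra -/

section PowerDerivatives

variable {𝔸 : Type*} [Ring 𝔸]

/-- The first derivative of `X ↦ X ^ k` at `X` in the direction `D`, namely
`∑ X ^ p * D * X ^ q` over `p + q + 1 = k`, defined through the product rule. -/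
def powDeriv (X D : 𝔸) : ℕ → 𝔸
  | 0 => 0
  | k + 1 => X * powDeriv X D k + D * X ^ k

/-- Half the second derivative of `X ↦ X ^ k` at `X` in the direction `D`, namely
`∑ X ^ p * D * X ^ q * D * X ^ r` over `p + q + r + 2 = k`, defined through the product rule. -/
def powDerivTwo (X D : 𝔸) : ℕ → 𝔸
  | 0 => 0
  | k + 1 => X * powDerivTwo X D k + D * powDeriv X D k

lemma powDeriv_succ (X D : 𝔸) (k : ℕ) :
    powDeriv X D (k + 1) = ∑ x ∈ antidiagonal k, X ^ x.1 * D * X ^ x.2 := by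
  induction k with
  | zero => simp [powDeriv]
  | succ k ih =>
    rw [powDeriv, ih, Nat.sum_antidiagonal_succ, mul_sum, add_comm]
    simp [pow_succ', mul_assoc]

lemma powDerivTwo_add_two (X D : 𝔸) (k : ℕ) :
    powDerivTwo X D (k + 2) = ∑ x ∈ antidiagonal k, X ^ x.1 * D * powDeriv X D (x.2 + 1) := by
  induction k with
  | zero => simp [powDerivTwo, powDeriv]
  | succ k ih =>
    rw [powDerivTwo, ih, Nat.sum_antidiagonal_succ, mul_sum, add_comm]
    simp [pow_succ', mul_assoc]

lemma sum_range_smul_sum_antidiagonal {M : Type*} [AddCommGroup M] [Module ℝ M] (a : ℕ → ℝ)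
    {N : ℕ} (ha : ∀ k, N ≤ k → a k = 0) (F : ℕ → ℕ → M) :
    ∑ k ∈ range N, a k • ∑ x ∈ antidiagonal k, F x.1 x.2 =
      ∑ p ∈ range N, ∑ q ∈ range N, a (p + q) • F p q := by
  have h : ∀ k ∈ range N, a k • ∑ x ∈ antidiagonal k, F x.1 x.2 =
      ∑ x ∈ range N ×ˢ range N, if x.1 + x.2 = k then a k • F x.1 x.2 else 0 := by
    intro k hk
    rw [mem_range] at hk
    have : antidiagonal k = (range N ×ˢ range N).filter fun x => x.1 + x.2 = k := by
      ext x; simp; omega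
    rw [this, smul_sum, sum_filter]
  rw [sum_congr rfl h, sum_comm, ← sum_product' (range N) (range N) fun p q => a (p + q) • F p q]
  refine sum_congr rfl fun x _ => ?_
  rw [sum_ite_eq]
  split_ifs with hx
  · rfl
  · rw [ha _ (by simpa using hx), zero_smul]

variable [Algebra ℝ 𝔸]

/-- The first derivative of the polynomial with coefficients `a`. -/
lemma sum_range_smul_powDeriv (a : ℕ → ℝ) {N : ℕ} (ha : ∀ k, N < k → a k = 0) (X D : 𝔸) :
    ∑ k ∈ range (N + 1), a k • powDeriv X D k =
      ∑ p ∈ range N, ∑ q ∈ range N, a (p + q + 1) • (X ^ p * D * X ^ q) := by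
  rw [sum_range_succ', ← sum_range_smul_sum_antidiagonal (fun k => a (k + 1))
    (fun k hk => ha _ (by omega)) fun p q => X ^ p * D * X ^ q]
  simp [powDeriv_succ, show powDeriv X D 0 = 0 from rfl]

/-- Half the second derivative of the polynomial with coefficients `a`. -/
lemma sum_range_smul_powDerivTwo (a : ℕ → ℝ) {N : ℕ} (ha : ∀ k, N < k → a k = 0) (X D : 𝔸) :
    ∑ k ∈ range (N + 1), a k • powDerivTwo X D k =
      ∑ p ∈ range N, ∑ q ∈ range N, ∑ r ∈ range N,
        a (p + q + r + 2) • (X ^ p * D * X ^ q * D * X ^ r) := by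
  have h1 : ∑ k ∈ range (N + 1), a k • powDerivTwo X D k =
      ∑ k ∈ range N, a (k + 2) • powDerivTwo X D (k + 2) := by
    have h := sum_range_succ (fun k => a k • powDerivTwo X D k) (N + 1)
    rw [sum_range_succ', sum_range_succ', ha (N + 1) (by omega)] at h
    simpa [powDerivTwo, powDeriv] using h.symm
  rw [h1]
  simp_rw [powDerivTwo_add_two]
  rw [sum_range_smul_sum_antidiagonal (fun k => a (k + 2))
    (fun k hk => ha _ (by omega)) fun p q => X ^ p * D * powDeriv X D (q + 1)]
  refine sum_congr rfl fun p _ => ?_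
  have h2 := sum_range_smul_sum_antidiagonal (N := N) (fun k => a (p + k + 2))
    (fun k hk => ha _ (by omega)) fun q r => X ^ q * D * X ^ r
  simp only [← powDeriv_succ] at h2
  simp_rw [← mul_smul_comm, ← mul_sum]
  rw [h2]
  simp_rw [mul_sum, mul_smul_comm, mul_assoc, add_assoc]

end PowerDerivatives

section Derivatives

variable {𝔸 : Type*} [NormedRing 𝔸] [NormedAlgebra ℝ 𝔸]

lemma hasDerivAt_add_smul (X D : 𝔸) (t : ℝ) : HasDerivAt (fun t : ℝ => X + t • D) D t := by
  simpa using ((hasDerivAt_id t).smul_const D).const_add X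

lemma hasDerivAt_pow_add_smul (X D : 𝔸) (k : ℕ) (t : ℝ) :
    HasDerivAt (fun t : ℝ => (X + t • D) ^ k) (powDeriv (X + t • D) D k) t := by
  induction k with
  | zero => simpa [powDeriv] using hasDerivAt_const t (1 : 𝔸)
  | succ k ih =>
    simp_rw [pow_succ', powDeriv]
    have h := (hasDerivAt_add_smul X D t).fun_mul ih
    rwa [add_comm] at h

lemma hasDerivAt_powDeriv_add_smul (X D : 𝔸) (k : ℕ) (t : ℝ) :
    HasDerivAt (fun t : ℝ => powDeriv (X + t • D) D k)
      ((2 : ℝ) • powDerivTwo (X + t • D) D k) t := by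
  induction k with
  | zero => simpa [powDeriv, powDerivTwo] using hasDerivAt_const t (0 : 𝔸)
  | succ k ih =>
    simp_rw [powDeriv, powDerivTwo]
    have h := ((hasDerivAt_add_smul X D t).fun_mul ih).fun_add
      ((hasDerivAt_pow_add_smul X D k t).const_mul D)
    have e : (2 : ℝ) • ((X + t • D) * powDerivTwo (X + t • D) D k + D * powDeriv (X + t • D) D k) =
        D * powDeriv (X + t • D) D k + (X + t • D) * (2 : ℝ) • powDerivTwo (X + t • D) D k +
          D * powDeriv (X + t • D) D k := by
      rw [smul_add, mul_smul_comm, two_smul ℝ (D * _)]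
      abel
    rwa [e]

end Derivatives

/-! ### The moment polynomial on self-adjoint operators -/

section MomentPolynomial

/-- The polynomial of degree `m` whose coefficients are the moments of `{1, …, n}`, with the
variable scaled by `ε`. -/
noncomputable def momentPolynomial (n m : ℕ) (ε : ℝ) : ℝ[X] :=
  ∑ k ∈ range (m + 1), monomial k (powerMoment n k * ε ^ k)

lemma coeff_momentPolynomial (n m : ℕ) (ε : ℝ) (k : ℕ) :
    (momentPolynomial n m ε).coeff k = if k ≤ m then powerMoment n k * ε ^ k else 0 := by
  simp [momentPolynomial, coeff_monomial]

lemma degree_momentPolynomial {n : ℕ} (hn : 0 < n) (m : ℕ) {ε : ℝ} (hε : 0 < ε) :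
    (momentPolynomial n m ε).degree = m := by
  refine degree_eq_of_le_of_coeff_ne_zero (degree_le_iff_coeff_zero _ _ |>.2 fun k hk => ?_) ?_
  · rw [coeff_momentPolynomial, if_neg (by simpa using hk)]
  · rw [coeff_momentPolynomial, if_pos le_rfl]
    exact (mul_pos (powerMoment_pos hn m) (pow_pos hε m)).ne'

end MomentPolynomial

section Operators

variable {E : Type*} [NormedAddCommGroup E] [InnerProductSpace ℂ E]

/-- The real part `re ⟪w, M w⟫` of the quadratic form of an operator `M`, as a real-linear
functional of `M`. -/
noncomputable def reQuadForm (w : E) : (E →L[ℂ] E) →L[ℝ] ℝ :=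
  Complex.reCLM ∘L ((innerSL ℂ w) ∘L (ContinuousLinearMap.apply ℂ E w)).restrictScalars ℝ

@[simp] lemma reQuadForm_apply (w : E) (M : E →L[ℂ] E) :
    reQuadForm w M = (inner ℂ w (M w)).re := rfl

lemma hasDerivAt_reQuadForm_aeval (w : E) (g : ℝ[X]) {m : ℕ} (hg : g.natDegree ≤ m)
    (X D : E →L[ℂ] E) (t : ℝ) :
    HasDerivAt (fun t : ℝ => reQuadForm w (aeval (X + t • D) g))
      (reQuadForm w (∑ k ∈ range (m + 1), g.coeff k • powDeriv (X + t • D) D k)) t := by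
  refine (reQuadForm w).hasFDerivAt.comp_hasDerivAt t ?_
  simp_rw [aeval_eq_sum_range' (Nat.lt_succ_of_le hg)]
  exact HasDerivAt.fun_sum fun k _ => (hasDerivAt_pow_add_smul X D k t).fun_const_smul _

lemma hasDerivAt_reQuadForm_sum_powDeriv (w : E) (g : ℝ[X]) (m : ℕ)
    (X D : E →L[ℂ] E) (t : ℝ) :
    HasDerivAt
      (fun t : ℝ => reQuadForm w (∑ k ∈ range (m + 1), g.coeff k • powDeriv (X + t • D) D k))
      (2 * reQuadForm w (∑ k ∈ range (m + 1), g.coeff k • powDerivTwo (X + t • D) D k)) t := by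
  rw [← smul_eq_mul, ← map_smul, smul_sum]
  refine (reQuadForm w).hasFDerivAt.comp_hasDerivAt t ?_
  refine HasDerivAt.fun_sum fun k _ => ?_
  rw [smul_comm (2 : ℝ) (g.coeff k)]
  exact (hasDerivAt_powDeriv_add_smul X D k t).fun_const_smul _

variable [FiniteDimensional ℂ E]

lemma inner_pow_mul_apply {X : E →L[ℂ] E} (hX : IsSelfAdjoint X) (p : ℕ) (M : E →L[ℂ] E) (w : E) :
    inner ℂ w ((X ^ p * M) w) = inner ℂ ((X ^ p) w) (M w) := by
  rw [mul_apply_eq_comp, ← ContinuousLinearMap.adjoint_inner_left,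
    ← ContinuousLinearMap.star_eq_adjoint, (hX.pow p).star_eq]

/-- The derivative of the moment polynomial in a positive direction `S† S` is positive: its
quadratic form at `w` is the scaled Hankel form of the vectors `S X ^ p w`. -/
lemma exists_pos_forall_reQuadForm_powDeriv_nonneg {m : ℕ}
    (hm : 2 * Module.finrank ℂ E ≤ m) (R : ℝ) :
    ∃ ε₀ > 0, ∀ ε : ℝ, 0 < ε → ε ≤ ε₀ → ∀ (X S : E →L[ℂ] E) (w : E), IsSelfAdjoint X → ‖X‖ ≤ R →
      0 ≤ reQuadForm w (∑ k ∈ range (m + 1),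
        (momentPolynomial (Module.finrank ℂ E) m ε).coeff k • powDeriv X (star S * S) k) := by
  set n := Module.finrank ℂ E
  obtain ⟨K, hK, hKX⟩ := exists_norm_map_pow_le (E := E) R
  -- The first derivative has no middle power of `X`: only `q = 0` occurs, whence `Q = 1`.
  obtain ⟨ε₀, hε₀, h⟩ := exists_pos_forall_scaled_form_nonneg (E := E) (n := n) m one_pos
    (by omega) (fun k => if k + 1 ≤ m then powerMoment n (k + 1) else 0) 1
    (fun p hp r hr => if_pos (by omega)) hK R
  refine ⟨ε₀, hε₀, fun ε hε hε' X S w hX hXR => ?_⟩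
  have h' := h ε hε hε' X (fun p => S ((X ^ p) w)) hXR (hKX X S w hXR)
  rw [sum_range_smul_powDeriv _ fun k hk => by
    rw [coeff_momentPolynomial, if_neg (by omega)]]
  refine (mul_nonneg hε.le h').trans_eq ?_
  simp_rw [map_sum, map_smul, mul_sum]
  refine sum_congr rfl fun p _ => ?_
  rw [range_one, sum_singleton]
  refine sum_congr rfl fun r _ => ?_
  rw [reQuadForm_apply, mul_assoc (X ^ p), inner_pow_mul_apply hX, mul_assoc (star S),
    mul_apply_eq_comp,
    ContinuousLinearMap.star_eq_adjoint, ContinuousLinearMap.adjoint_inner_right,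
    mul_apply_eq_comp, coeff_momentPolynomial]
  simp only [add_zero, pow_zero, one_apply_eq_self, smul_eq_mul]
  split_ifs <;> ring

/-- The second derivative of the moment polynomial is positive: its quadratic form at `w` is the
scaled form of the vectors `D X ^ p w`, whose part with `q = 0` is a Hankel form. -/
lemma exists_pos_forall_reQuadForm_powDerivTwo_nonneg {m : ℕ} (hm0 : 0 < m)
    (hm : 2 * Module.finrank ℂ E ≤ m) (R : ℝ) :
    ∃ ε₀ > 0, ∀ ε : ℝ, 0 < ε → ε ≤ ε₀ → ∀ (X D : E →L[ℂ] E) (w : E), IsSelfAdjoint X →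
      IsSelfAdjoint D → ‖X‖ ≤ R → 0 ≤ reQuadForm w (∑ k ∈ range (m + 1),
        (momentPolynomial (Module.finrank ℂ E) m ε).coeff k • powDerivTwo X D k) := by
  set n := Module.finrank ℂ E
  obtain ⟨K, hK, hKX⟩ := exists_norm_map_pow_le (E := E) R
  obtain ⟨ε₀, hε₀, h⟩ := exists_pos_forall_scaled_form_nonneg (E := E) (n := n) m hm0
    (by omega) (fun k => if k + 2 ≤ m then powerMoment n (k + 2) else 0) 2
    (fun p hp r hr => if_pos (by omega)) hK R
  refine ⟨ε₀, hε₀, fun ε hε hε' X D w hX hD hXR => ?_⟩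
  have h' := h ε hε hε' X (fun p => D ((X ^ p) w)) hXR (hKX X D w hXR)
  rw [sum_range_smul_powDerivTwo _ fun k hk => by
    rw [coeff_momentPolynomial, if_neg (by omega)]]
  refine (mul_nonneg (sq_nonneg ε) h').trans_eq ?_
  simp_rw [map_sum, map_smul, mul_sum]
  refine sum_congr rfl fun p _ => sum_congr rfl fun q _ => sum_congr rfl fun r _ => ?_
  rw [reQuadForm_apply, mul_assoc _ D, mul_assoc _ (X ^ q), mul_assoc (X ^ p),
    inner_pow_mul_apply hX,
    mul_apply_eq_comp, ← ContinuousLinearMap.adjoint_inner_left D,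
    ← ContinuousLinearMap.star_eq_adjoint, hD.star_eq, mul_apply_eq_comp, mul_apply_eq_comp,
    coeff_momentPolynomial]
  simp only [smul_eq_mul]
  split_ifs <;> ring

lemma isSelfAdjoint_add_smul_sub {X Y : E →L[ℂ] E} (hX : IsSelfAdjoint X) (hY : IsSelfAdjoint Y)
    (t : ℝ) : IsSelfAdjoint (X + t • (Y - X)) :=
  hX.add ((IsSelfAdjoint.all t).smul (hY.sub hX))

omit [FiniteDimensional ℂ E] in
lemma norm_add_smul_sub_le {X Y : E →L[ℂ] E} {R : ℝ} (hX : ‖X‖ ≤ R) (hY : ‖Y‖ ≤ R) {t : ℝ}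
    (ht : t ∈ Set.Icc (0 : ℝ) 1) : ‖X + t • (Y - X)‖ ≤ R := by
  simpa using (convex_closedBall (0 : E →L[ℂ] E) R).add_smul_sub_mem (by simpa using hX)
    (by simpa using hY) ht

/-- For small `ε`, the moment polynomial is monotone and convex on self-adjoint operators of norm at
most `R`. Positivity of an operator `Y - X` is expressed as `Y - X = S† S`. -/
lemma exists_pos_momentPolynomial_monotone_convex {m : ℕ} (hm0 : 0 < m)
    (hm : 2 * Module.finrank ℂ E ≤ m) (R : ℝ) :
    ∃ ε > 0,
      (∀ (X Y S : E →L[ℂ] E) (w : E), IsSelfAdjoint X → IsSelfAdjoint Y → ‖X‖ ≤ R → ‖Y‖ ≤ R →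
        Y - X = star S * S →
        reQuadForm w (aeval X (momentPolynomial (Module.finrank ℂ E) m ε)) ≤
          reQuadForm w (aeval Y (momentPolynomial (Module.finrank ℂ E) m ε))) ∧
      ∀ (X Y : E →L[ℂ] E) (w : E), IsSelfAdjoint X → IsSelfAdjoint Y → ‖X‖ ≤ R → ‖Y‖ ≤ R →
        ∀ l ∈ Set.Icc (0 : ℝ) 1,
        reQuadForm w (aeval (l • X + (1 - l) • Y) (momentPolynomial (Module.finrank ℂ E) m ε)) ≤
          l * reQuadForm w (aeval X (momentPolynomial (Module.finrank ℂ E) m ε)) +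
          (1 - l) * reQuadForm w (aeval Y (momentPolynomial (Module.finrank ℂ E) m ε)) := by
  obtain ⟨ε₁, hε₁, h₁⟩ := exists_pos_forall_reQuadForm_powDeriv_nonneg (E := E) hm R
  obtain ⟨ε₂, hε₂, h₂⟩ := exists_pos_forall_reQuadForm_powDerivTwo_nonneg (E := E) hm0 hm R
  have hε : 0 < min ε₁ ε₂ := lt_min hε₁ hε₂
  set g := momentPolynomial (Module.finrank ℂ E) m (min ε₁ ε₂) with hg
  have hgm : g.natDegree ≤ m := natDegree_le_iff_coeff_eq_zero.2 fun k hk => by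
    rw [hg, coeff_momentPolynomial, if_neg (by omega)]
  refine ⟨_, hε, fun X Y S w hX hY hXR hYR hS => ?_, fun X Y w hX hY hXR hYR l hl => ?_⟩
  · have hmono : MonotoneOn (fun t : ℝ => reQuadForm w (aeval (X + t • (Y - X)) g))
        (Set.Icc 0 1) := by
      refine monotoneOn_of_hasDerivWithinAt_nonneg (convex_Icc 0 1)
        (fun t _ => (hasDerivAt_reQuadForm_aeval w g hgm X _ t).continuousAt.continuousWithinAt)
        (fun t _ => (hasDerivAt_reQuadForm_aeval w g hgm X _ t).hasDerivWithinAt) fun t ht => ?_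
      have := h₁ _ hε (min_le_left _ _) (X + t • (Y - X)) S w
        (isSelfAdjoint_add_smul_sub hX hY t)
        (norm_add_smul_sub_le hXR hYR (interior_subset ht))
      rwa [← hS] at this
    simpa using hmono (by simp) (by simp) (zero_le_one (α := ℝ))
  · have hconv : ConvexOn ℝ (Set.Icc 0 1)
        (fun t : ℝ => reQuadForm w (aeval (Y + t • (X - Y)) g)) := by
      refine convexOn_of_hasDerivWithinAt2_nonneg (convex_Icc 0 1)
        (fun t _ => (hasDerivAt_reQuadForm_aeval w g hgm Y _ t).continuousAt.continuousWithinAt)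
        (fun t _ => (hasDerivAt_reQuadForm_aeval w g hgm Y _ t).hasDerivWithinAt)
        (fun t _ => (hasDerivAt_reQuadForm_sum_powDeriv w g m Y _ t).hasDerivWithinAt)
        fun t ht => mul_nonneg zero_le_two ?_
      exact h₂ _ hε (min_le_right _ _) (Y + t • (X - Y)) (X - Y) w
        (isSelfAdjoint_add_smul_sub hY hX t) (hX.sub hY)
        (norm_add_smul_sub_le hYR hXR (interior_subset ht))
    have h := hconv.2 (x := 1) (by simp) (y := 0) (by simp) hl.1 (sub_nonneg.2 hl.2)
      (by ring)
    have e : l • X + (1 - l) • Y = Y + l • (X - Y) := by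
      rw [sub_smul, one_smul, smul_sub]; abel
    rw [e]
    simpa using h

end Operators

/-! ### From operators to matrices -/

section Matrices

open scoped MatrixOrder ComplexOrder

variable {n : ℕ}

lemma Matrix.IsHermitian.isSelfAdjoint_toEuclideanCLM {A : Matrix (Fin n) (Fin n) ℂ}
    (hA : A.IsHermitian) : IsSelfAdjoint (Matrix.toEuclideanCLM (𝕜 := ℂ) A) := by
  rw [isSelfAdjoint_iff, ← map_star, Matrix.star_eq_conjTranspose, hA.eq]

lemma norm_toEuclideanCLM_le_of_spectrum_subset {A : Matrix (Fin n) (Fin n) ℂ}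
    (hA : A.IsHermitian) {R : ℝ} (hR : 0 ≤ R) (hs : spectrum ℝ A ⊆ Set.Icc (-R) R) :
    ‖Matrix.toEuclideanCLM (𝕜 := ℂ) A‖ ≤ R := by
  set Φ := Matrix.toEuclideanCLM (𝕜 := ℂ) (n := Fin n)
  have hsa : IsSelfAdjoint (Φ A) := hA.isSelfAdjoint_toEuclideanCLM
  have hspec : spectrum ℝ (Φ A) = spectrum ℝ A :=
    AlgEquiv.spectrum_eq (Φ.toAlgEquiv.restrictScalars ℝ) A
  rw [← cfc_id ℝ (Φ A)]
  refine norm_cfc_le hR fun x hx => ?_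
  rw [hspec] at hx
  exact abs_le.2 (hs hx)

lemma toEuclideanCLM_aeval (A : Matrix (Fin n) (Fin n) ℂ) (g : ℝ[X]) :
    Matrix.toEuclideanCLM (𝕜 := ℂ) (aeval A g) = aeval (Matrix.toEuclideanCLM (𝕜 := ℂ) A) g :=
  (aeval_algHom_apply ((Matrix.toEuclideanCLM (𝕜 := ℂ) (n := Fin n)).toAlgEquiv.restrictScalars
    ℝ).toAlgHom A g).symm

lemma cfc_eval_eq_aeval {A : Matrix (Fin n) (Fin n) ℂ} (hA : A.IsHermitian) (g : ℝ[X]) :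
    cfc (fun t => g.eval t) A = aeval A g :=
  cfc_polynomial g A hA

lemma isHermitian_aeval {A : Matrix (Fin n) (Fin n) ℂ} (hA : A.IsHermitian) (g : ℝ[X]) :
    (aeval A g).IsHermitian := by
  rw [← cfc_eval_eq_aeval hA g]
  exact cfc_predicate _ A

lemma le_of_forall_reQuadForm_le {A B : Matrix (Fin n) (Fin n) ℂ} (hA : A.IsHermitian)
    (hB : B.IsHermitian)
    (h : ∀ w, reQuadForm w (Matrix.toEuclideanCLM (𝕜 := ℂ) A) ≤
      reQuadForm w (Matrix.toEuclideanCLM (𝕜 := ℂ) B)) : A ≤ B := by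
  rw [Matrix.le_iff]
  refine .of_dotProduct_mulVec_nonneg (hB.sub hA) fun x => ?_
  have e : star x ⬝ᵥ ((B - A).mulVec x) =
      inner ℂ (WithLp.toLp 2 x) (Matrix.toEuclideanCLM (𝕜 := ℂ) (B - A) (WithLp.toLp 2 x)) := by
    rw [Matrix.toEuclideanCLM_toLp, EuclideanSpace.inner_toLp_toLp, dotProduct_comm]
  have him := (hB.sub hA).im_star_dotProduct_mulVec_self x
  have h' := h (WithLp.toLp 2 x)
  rw [← sub_nonneg, ← map_sub, ← map_sub, reQuadForm_apply, ← e] at h'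
  exact Complex.nonneg_iff.2 ⟨h', him.symm⟩

lemma exists_degree_eq_matrixMonotone_matrixConvex {m : ℕ} (hn : 0 < n) (hmn : 2 * n ≤ m)
    {I : Set ℝ} (hI : Bornology.IsBounded I) :
    ∃ g : ℝ[X], g.degree = m ∧ IsMatrixConvexOn n I (fun t => g.eval t) ∧
      IsMatrixMonotoneOn n I (fun t => g.eval t) := by
  -- `R` may be negative when `I` is empty, so `max R 0` is used as the bound.
  obtain ⟨R, hR⟩ := hI.subset_closedBall 0
  have hIR : I ⊆ Set.Icc (-max R 0) (max R 0) := fun x hx => by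
    have := hR hx
    rw [mem_closedBall_zero_iff, Real.norm_eq_abs] at this
    exact abs_le.1 (this.trans (le_max_left _ _))
  have hfin : Module.finrank ℂ (EuclideanSpace ℂ (Fin n)) = n := finrank_euclideanSpace_fin
  obtain ⟨ε, hε, hmono, hconv⟩ := exists_pos_momentPolynomial_monotone_convex
    (E := EuclideanSpace ℂ (Fin n)) (m := m) (by omega) (by omega) (max R 0)
  rw [hfin] at hmono hconv
  set g := momentPolynomial n m ε
  have hnorm : ∀ {A : Matrix (Fin n) (Fin n) ℂ}, A.IsHermitian → spectrum ℝ A ⊆ I →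
      ‖Matrix.toEuclideanCLM (𝕜 := ℂ) A‖ ≤ max R 0 := fun hA hs =>
    norm_toEuclideanCLM_le_of_spectrum_subset hA (le_max_right _ _) (hs.trans hIR)
  have hsa : ∀ {A : Matrix (Fin n) (Fin n) ℂ}, A.IsHermitian →
      IsSelfAdjoint (Matrix.toEuclideanCLM (𝕜 := ℂ) A) := fun hA => hA.isSelfAdjoint_toEuclideanCLM
  have hsmul : ∀ (l : ℝ) (A : Matrix (Fin n) (Fin n) ℂ),
      Matrix.toEuclideanCLM (𝕜 := ℂ) (l • A) = l • Matrix.toEuclideanCLM (𝕜 := ℂ) A := fun l A =>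
    map_smul ((Matrix.toEuclideanCLM (𝕜 := ℂ) (n := Fin n)).toAlgEquiv.restrictScalars ℝ) l A
  have hsm : ∀ (l : ℝ) {A : Matrix (Fin n) (Fin n) ℂ}, A.IsHermitian → (l • A).IsHermitian :=
    fun l A hA => (IsSelfAdjoint.all l).smul hA.isSelfAdjoint
  refine ⟨g, degree_momentPolynomial hn m hε, fun A B hA hB hAI hBI l hl => ?_,
    fun A B hA hB hAI hBI hAB => ?_⟩
  · have hAB : (l • A + (1 - l) • B).IsHermitian := (hsm l hA).add (hsm (1 - l) hB)
    rw [cfc_eval_eq_aeval hAB, cfc_eval_eq_aeval hA, cfc_eval_eq_aeval hB]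
    refine le_of_forall_reQuadForm_le (isHermitian_aeval hAB g)
      ((hsm l (isHermitian_aeval hA g)).add (hsm (1 - l) (isHermitian_aeval hB g))) fun w => ?_
    rw [map_add, hsmul, hsmul, map_add, map_smul, map_smul]
    simp_rw [toEuclideanCLM_aeval]
    rw [map_add, hsmul, hsmul]
    exact hconv _ _ w (hsa hA) (hsa hB) (hnorm hA hAI) (hnorm hB hBI) l hl
  · rw [cfc_eval_eq_aeval hA, cfc_eval_eq_aeval hB]
    refine le_of_forall_reQuadForm_le (isHermitian_aeval hA g) (isHermitian_aeval hB g) fun w => ?_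
    simp_rw [toEuclideanCLM_aeval]
    obtain ⟨S, hS⟩ := CStarAlgebra.nonneg_iff_eq_star_mul_self.1 (sub_nonneg.2 hAB)
    refine hmono _ _ (Matrix.toEuclideanCLM (𝕜 := ℂ) S) w (hsa hA) (hsa hB) (hnorm hA hAI)
      (hnorm hB hBI) ?_
    rw [← map_sub, hS, map_mul, map_star]

/-! ### Reflection to the concave case -/

lemma IsMatrixConvexOn.comp_neg {I : Set ℝ} {g : ℝ[X]}
    (h : IsMatrixConvexOn n (-I) fun t => g.eval t) :
    IsMatrixConvexOn n I fun t => (g.comp (-X)).eval t := by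
  intro A B hA hB hAI hBI l hl
  have hsm : ∀ (l : ℝ) {A : Matrix (Fin n) (Fin n) ℂ}, A.IsHermitian → (l • A).IsHermitian :=
    fun l A hA => (IsSelfAdjoint.all l).smul hA.isSelfAdjoint
  have hc : ∀ {M : Matrix (Fin n) (Fin n) ℂ}, M.IsHermitian →
      cfc (fun t => (g.comp (-X)).eval t) M = cfc (fun t => g.eval t) (-M) := fun {M} hM => by
    rw [cfc_eval_eq_aeval hM, cfc_eval_eq_aeval hM.neg, aeval_comp, map_neg, aeval_X]
  rw [hc ((hsm l hA).add (hsm (1 - l) hB)), hc hA, hc hB]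
  have := h (-A) (-B) hA.neg hB.neg (by rwa [← spectrum.neg_eq, Set.neg_subset_neg])
    (by rwa [← spectrum.neg_eq, Set.neg_subset_neg]) l hl
  rwa [smul_neg, smul_neg, ← neg_add] at this

lemma IsMatrixMonotoneOn.neg_comp_neg {I : Set ℝ} {g : ℝ[X]}
    (h : IsMatrixMonotoneOn n (-I) fun t => g.eval t) :
    IsMatrixMonotoneOn n I fun t => (-g.comp (-X)).eval t := by
  intro A B hA hB hAI hBI hAB
  have hc : ∀ {M : Matrix (Fin n) (Fin n) ℂ}, M.IsHermitian →
      cfc (fun t => (-g.comp (-X)).eval t) M = -cfc (fun t => g.eval t) (-M) := fun {M} hM => by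
    rw [cfc_eval_eq_aeval hM, cfc_eval_eq_aeval hM.neg, map_neg, aeval_comp, map_neg, aeval_X]
  rw [hc hA, hc hB]
  refine neg_le_neg (h (-B) (-A) hB.neg hA.neg ?_ ?_ (neg_le_neg hAB)) <;>
    rwa [← spectrum.neg_eq, Set.neg_subset_neg]


theorem proposition1p3 (I : Set ℝ) (hI : I.OrdConnected) (hfin : Bornology.IsBounded I)
    (m n : ℕ) (hmn : 2 * n ≤ m) :
    (∃ f : Polynomial ℝ, f.degree = (m : WithBot ℕ) ∧
      IsMatrixConcaveOn n I (fun t => f.eval t) ∧ IsMatrixMonotoneOn n I (fun t => f.eval t)) ∧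
    (∃ g : Polynomial ℝ, g.degree = (m : WithBot ℕ) ∧
      IsMatrixConvexOn n I (fun t => g.eval t) ∧ IsMatrixMonotoneOn n I (fun t => g.eval t)) := by
  rcases Nat.eq_zero_or_pos n with rfl | hn
  -- For `n = 0` all matrices are equal, while the moments `powerMoment 0 k` vanish.
  · have hconv : ∀ f : ℝ → ℝ, IsMatrixConvexOn 0 I f := fun f A B _ _ _ _ l _ =>
      (Subsingleton.elim _ _).le
    have hmono : ∀ f : ℝ → ℝ, IsMatrixMonotoneOn 0 I f := fun f A B _ _ _ _ _ =>
      (Subsingleton.elim _ _).le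
    exact ⟨⟨X ^ m, degree_X_pow m, hconv _, hmono _⟩, ⟨X ^ m, degree_X_pow m, hconv _, hmono _⟩⟩
  refine ⟨?_, exists_degree_eq_matrixMonotone_matrixConvex hn hmn hfin⟩
  obtain ⟨g, hdeg, hconv, hmono⟩ :=
    exists_degree_eq_matrixMonotone_matrixConvex hn hmn (I := -I) hfin.neg
  refine ⟨-g.comp (-X), ?_, ?_, hmono.neg_comp_neg⟩
  · rw [degree_neg, degree_comp_neg_X, hdeg]
  · have := hconv.comp_neg
    simpa [IsMatrixConcaveOn] using this

end Matrices
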